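/- Let $\Gamma$ be a discrete group acting by homeomorphisms on a compact Hausdorff space $X$, equipped with its unique compatible uniform structure. For a continuous function $\varphi\colon X\to\mathbb C$ and $x\in X$ put $\varphi_x\colon\Gamma\to\mathbb C$, $\varphi_x(g)=\varphi(gx)$, and let $\gamma=\Gamma x$ be the orbit of $x$ and $\overline\gamma$ its closure. The action is called Lyapunov stable if for every entourage $\mathbb U$ and every $x\in X$ there is an entourage $\mathbb V$ such that $(x,y)\in\mathbb V$ implies $(gx,gy)\in\mathbb U$ for all $g\in\Gamma$. A function $f\colon\Gamma\to\mathbb C$ is almost periodic if the set of its translates $h\mapsto f(hg)$, $g\in\Gamma$, is totally bounded for the uniform distance. An invariant mean is a positive linear functional $M$ on the space of almost periodic functions on $\Gamma$ with $M(1)=1$ that is invariant under left and right translations. There is exactly one invariant mean $M$ on the almost periodic functions on $\Gamma$, and the following hold. 1) If the action is Lyapunov stable, then for every $x\in X$ there is exactly one $\Gamma$-invariant regular Borel probability measure $\mu_{\overline\gamma}$ on $\overline\gamma$, and for every continuous $\varphi\colon X\to\mathbb C$ the function $\varphi_x$ is almost periodic and $$M(\varphi_x)=\int_{\overline\gamma}\varphi|_{\overline\gamma}\,d\mu_{\overline\gamma}.$$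 2) If $x\in X$ has a finite orbit $\gamma$ (the action need not be Lyapunov stable), then for every continuous $\varphi\colon X\to\mathbb C$ the function $\varphi_x$ is almost periodic and $$M(\varphi_x)=\frac1{\#\gamma}\sum_{y\in\gamma}\varphi(y).$$ -/

import Mathlib

open MeasureTheory
open scoped ComplexOrder UniformConvergence

/-- The right translate `h ↦ f (h * g)` of a function on a group, as an element of the space
of functions `Γ → ℂ` with the uniform structure of uniform convergence on all of `Γ`. -/
def rightTranslate {Γ : Type*} [Group Γ] (f : Γ → ℂ) (g : Γ) : Γ →ᵤ ℂ :=
  UniformFun.ofFun fun h => f (h * g)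

/-- A function on a (discrete) group is almost periodic if the set of its translates is totally
bounded (equivalently, relatively compact) for uniform convergence, i.e. has a finite
`ε`-net in the sup-distance for each `ε > 0`. Such a function is automatically bounded. -/
def IsAlmostPeriodic {Γ : Type*} [Group Γ] (f : Γ → ℂ) : Prop :=
  TotallyBounded (Set.range (rightTranslate f))

theorem IsAlmostPeriodic.add {Γ : Type*} [Group Γ] {f f' : Γ → ℂ}
    (hf : IsAlmostPeriodic f) (hf' : IsAlmostPeriodic f') : IsAlmostPeriodic (f + f') := by
  have hprod : TotallyBounded
      (Set.range (rightTranslate f) ×ˢ Set.range (rightTranslate f')) := by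
    rw [totallyBounded_iff_ultrafilter]
    intro F hF
    have h1 : Cauchy ((F.map Prod.fst : Ultrafilter (Γ →ᵤ ℂ)) : Filter (Γ →ᵤ ℂ)) := by
      refine totallyBounded_iff_ultrafilter.1 hf _ ?_
      exact (Filter.map_mono hF).trans (by
        rw [Filter.map_principal]
        exact Filter.principal_mono.2 (Set.fst_image_prod_subset _ _))
    have h2 : Cauchy ((F.map Prod.snd : Ultrafilter (Γ →ᵤ ℂ)) : Filter (Γ →ᵤ ℂ)) := by
      refine totallyBounded_iff_ultrafilter.1 hf' _ ?_
      exact (Filter.map_mono hF).trans (by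
        rw [Filter.map_principal]
        exact Filter.principal_mono.2 (Set.snd_image_prod_subset _ _))
    exact (h1.prod h2).mono Filter.le_prod_map_fst_snd
  have h := hprod.image (uniformContinuous_add (α := Γ →ᵤ ℂ))
  refine h.subset ?_
  rintro _ ⟨g, rfl⟩
  exact ⟨(rightTranslate f g, rightTranslate f' g), ⟨⟨g, rfl⟩, ⟨g, rfl⟩⟩, rfl⟩

theorem isAlmostPeriodic_const {Γ : Type*} [Group Γ] (c : ℂ) :
    IsAlmostPeriodic (fun _ : Γ => c) := by
  refine (Set.finite_singleton (UniformFun.ofFun (fun _ : Γ => c))).totallyBounded.subset ?_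
  rintro _ ⟨g, rfl⟩
  rfl

theorem IsAlmostPeriodic.const_smul {Γ : Type*} [Group Γ] {f : Γ → ℂ}
    (hf : IsAlmostPeriodic f) (c : ℂ) : IsAlmostPeriodic (c • f) := by
  have h := TotallyBounded.image hf
    (UniformFun.postcomp_uniformContinuous (α := Γ) (uniformContinuous_const_smul (X := ℂ) c))
  refine h.subset ?_
  rintro _ ⟨g, rfl⟩
  exact ⟨rightTranslate f g, ⟨g, rfl⟩, rfl⟩

theorem IsAlmostPeriodic.mul_left {Γ : Type*} [Group Γ] {f : Γ → ℂ}
    (hf : IsAlmostPeriodic f) (a : Γ) : IsAlmostPeriodic fun h => f (a * h) := by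
  have h := TotallyBounded.image hf
    (UniformFun.precomp_uniformContinuous (β := ℂ) (f := fun h : Γ => a * h))
  refine h.subset ?_
  rintro _ ⟨g, rfl⟩
  refine ⟨rightTranslate f g, ⟨g, rfl⟩, ?_⟩
  funext h
  exact congrArg f (mul_assoc a h g)

theorem IsAlmostPeriodic.mul_right {Γ : Type*} [Group Γ] {f : Γ → ℂ}
    (hf : IsAlmostPeriodic f) (a : Γ) : IsAlmostPeriodic fun h => f (h * a) := by
  refine TotallyBounded.subset ?_ hf
  rintro _ ⟨g, rfl⟩
  refine ⟨g * a, ?_⟩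
  funext h
  exact congrArg f (mul_assoc h g a).symm

/-- The complex vector space of almost periodic functions on `Γ`. -/
noncomputable def AlmostPeriodic (Γ : Type*) [Group Γ] : Submodule ℂ (Γ → ℂ) where
  carrier := {f | IsAlmostPeriodic f}
  add_mem' hf hf' := hf.add hf'
  zero_mem' := isAlmostPeriodic_const 0
  smul_mem' c _ hf := hf.const_smul c

/-- An invariant mean on the almost periodic functions: a linear functional that is normalized,
positive, and invariant under left and right translations. -/
structure IsInvariantMean {Γ : Type*} [Group Γ] (M : AlmostPeriodic Γ →ₗ[ℂ] ℂ) : Prop where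
  map_one : M ⟨fun _ => 1, isAlmostPeriodic_const 1⟩ = 1
  nonneg : ∀ f : AlmostPeriodic Γ, (∀ g, 0 ≤ f.1 g) → 0 ≤ M f
  left_invariant : ∀ (a : Γ) (f : AlmostPeriodic Γ),
    M ⟨fun h => f.1 (a * h), IsAlmostPeriodic.mul_left f.2 a⟩ = M f
  right_invariant : ∀ (a : Γ) (f : AlmostPeriodic Γ),
    M ⟨fun h => f.1 (h * a), IsAlmostPeriodic.mul_right f.2 a⟩ = M f

/-- Lyapunov stability of a group action on a uniform space. (A compact Hausdorff space has exactly
one compatible uniform structure.) -/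
def LyapunovStable (Γ X : Type*) [Group Γ] [UniformSpace X] [MulAction Γ X] : Prop :=
  ∀ U ∈ uniformity X, ∀ x : X, ∃ V ∈ uniformity X,
    ∀ y : X, (x, y) ∈ V → ∀ g : Γ, (g • x, g • y) ∈ U

/-- The function `φ_x : Γ → ℂ`, `φ_x g = φ (g x)`. -/
noncomputable def orbitFunction (Γ : Type*) {X : Type*} [Group Γ] [TopologicalSpace X] [MulAction Γ X]
    (φ : C(X, ℂ)) (x : X) : Γ → ℂ :=
  fun g => φ (g • x)

/-- The closure of the orbit of `x`, with the restricted action of `Γ`. -/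
def orbitClosure (Γ : Type*) {X : Type*} [Group Γ] [TopologicalSpace X] [MulAction Γ X]
    [ContinuousConstSMul Γ X] (x : X) : SubMulAction Γ X where
  carrier := closure (MulAction.orbit Γ x)
  smul_mem' g _ hy :=
    map_mem_closure (continuous_const_smul g) hy
      fun _ hz => MulAction.mem_orbit_of_mem_orbit g hz

/-- `μ` is a `Γ`-invariant regular Borel probability measure on the orbit closure of `x`. -/
structure IsInvariantProbability {Γ X : Type*} [Group Γ] [TopologicalSpace X] [MeasurableSpace X]
    [MulAction Γ X] [ContinuousConstSMul Γ X] {x : X} (μ : Measure (orbitClosure Γ x)) : Prop where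
  prob : IsProbabilityMeasure μ
  invariant : SMulInvariantMeasure Γ (orbitClosure Γ x) μ
  regular : μ.Regular

open scoped BigOperators Topology Uniformity

/-! Everything rests on von Neumann's description of the mean: for almost periodic `f`, suitable
finite averages of the two-sided translates `f (x * a i * y)` are uniformly close to a constant.
Existence is Maak's combinatorial argument: almost periodicity gives a finite fine colouring of the
group, and Hall's marriage theorem applied to a colouring with the fewest colours shows that
averaging over one representative per colour is nearly translation invariant
(`exists_isApproxMean_of_isFineColoring`). The constant is unique by a double average, and every
invariant mean must return it (`IsInvariantMean.eq_of_hasMean`).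

Applied to `φ_x`, the same averages are averages of `φ (a i • y)` along the orbit. Integrating them
against an invariant probability on the orbit closure, or averaging them over a finite orbit,
identifies the constant. Stability makes `φ_x` almost periodic; the Riesz theorem then turns the
mean into an invariant measure, which is unique because its integrals are prescribed. -/

theorem norm_expect_sub_le {ι : Type*} [Fintype ι] [Nonempty ι] {F : ι → ℂ} {c : ℂ} {ε : ℝ}
    (h : ∀ i, ‖F i - c‖ ≤ ε) : ‖(𝔼 i, F i) - c‖ ≤ ε := by
  have hcard : (0 : ℝ) < Fintype.card ι := by exact_mod_cast Fintype.card_pos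
  have h1 : (𝔼 i, F i) - c = (∑ i, (F i - c)) / Fintype.card ι := by
    rw [← Fintype.expect_eq_sum_div_card, Finset.expect_sub_distrib, Fintype.expect_const]
  rw [h1, norm_div, Complex.norm_natCast, div_le_iff₀ hcard]
  refine (norm_sum_le _ _).trans ((Finset.sum_le_sum fun i _ => h i).trans ?_)
  simp [mul_comm]

theorem norm_expect_sub_expect_le {ι : Type*} [Fintype ι] [Nonempty ι] {F G : ι → ℂ} {ε : ℝ}
    (h : ∀ i, ‖F i - G i‖ ≤ ε) : ‖(𝔼 i, F i) - 𝔼 i, G i‖ ≤ ε := by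
  rw [← Finset.expect_sub_distrib, ← sub_zero (𝔼 i, (F i - G i))]
  exact norm_expect_sub_le fun i => by simpa using h i

/-- Some finite family of two-sided translates of `f` has an average which is uniformly within
`ε` of the constant `c`. -/
def IsApproxMean {Γ : Type*} [Group Γ] (f : Γ → ℂ) (ε : ℝ) (c : ℂ) : Prop :=
  ∃ (ι : Type) (_ : Fintype ι) (_ : Nonempty ι) (a : ι → Γ),
    ∀ x y, ‖(𝔼 i, f (x * a i * y)) - c‖ ≤ ε

/-- `c` is the von Neumann mean of `f`: a uniform limit of averages of translates of `f`. -/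
def HasMean {Γ : Type*} [Group Γ] (f : Γ → ℂ) (c : ℂ) : Prop :=
  ∀ ε > 0, IsApproxMean f ε c

/-! ### Existence, uniqueness and linearity of von Neumann means. -/

section Mean

variable {Γ : Type*} [Group Γ] {f f' : Γ → ℂ} {c c' : ℂ} {ε ε' : ℝ}

/-- The double average of `f (a i * b j)` is near `c` when averaged over `i` first and near `c'`
when averaged over `j` first. -/
theorem IsApproxMean.norm_sub_le (h : IsApproxMean f ε c) (h' : IsApproxMean f ε' c') :
    ‖c - c'‖ ≤ ε + ε' := by
  obtain ⟨ι, _, _, a, ha⟩ := h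
  obtain ⟨κ, _, _, b, hb⟩ := h'
  have h1 : ‖(𝔼 j, 𝔼 i, f (a i * b j)) - c‖ ≤ ε :=
    norm_expect_sub_le fun j => by simpa using ha 1 (b j)
  have h2 : ‖(𝔼 i, 𝔼 j, f (a i * b j)) - c'‖ ≤ ε' :=
    norm_expect_sub_le fun i => by simpa using hb (a i) 1
  rw [Finset.expect_comm] at h2
  have h3 := _root_.norm_sub_le ((𝔼 j, 𝔼 i, f (a i * b j)) - c') ((𝔼 j, 𝔼 i, f (a i * b j)) - c)
  rw [sub_sub_sub_cancel_left] at h3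
  linarith

theorem IsApproxMean.mono_norm (h : IsApproxMean f ε c) (hc : ‖c - c'‖ ≤ ε') :
    IsApproxMean f (ε + ε') c' := by
  obtain ⟨ι, _, _, a, ha⟩ := h
  refine ⟨ι, ‹_›, ‹_›, a, fun x y => ?_⟩
  rw [← sub_add_sub_cancel _ c c']
  exact (norm_add_le _ _).trans (add_le_add (ha x y) hc)

theorem IsApproxMean.mono (h : IsApproxMean f ε c) (hε : ε ≤ ε') : IsApproxMean f ε' c := by
  obtain ⟨ι, _, _, a, ha⟩ := h
  refine ⟨ι, ‹_›, ‹_›, a, fun x y => ?_⟩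
  exact (ha x y).trans hε

theorem HasMean.unique (h : HasMean f c) (h' : HasMean f c') : c = c' := by
  rw [← sub_eq_zero, ← norm_le_zero_iff]
  refine le_of_forall_pos_le_add fun ε hε => ?_
  have := (h (ε / 2) (half_pos hε)).norm_sub_le (h' (ε / 2) (half_pos hε))
  linarith

theorem exists_hasMean_of_forall_isApproxMean (h : ∀ ε > 0, ∃ c, IsApproxMean f ε c) :
    ∃ c, HasMean f c := by
  choose u hu using fun n : ℕ => h (1 / ((n : ℝ) + 1)) (by positivity)
  have hlim : Filter.Tendsto (fun n : ℕ => 1 / ((n : ℝ) + 1)) Filter.atTop (𝓝 0) :=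
    tendsto_one_div_add_atTop_nhds_zero_nat
  have hcauchy : CauchySeq u := by
    refine cauchySeq_of_le_tendsto_0' (fun n : ℕ => 1 / ((n : ℝ) + 1) + 1 / ((n : ℝ) + 1))
      (fun n m hnm => ?_) (by simpa only [add_zero] using hlim.add hlim)
    rw [dist_eq_norm]
    have h1 := (hu n).norm_sub_le (hu m)
    have h2 : 1 / ((m : ℝ) + 1) ≤ 1 / ((n : ℝ) + 1) := Nat.one_div_le_one_div hnm
    linarith
  obtain ⟨c, hc⟩ := cauchySeq_tendsto_of_complete hcauchy
  refine ⟨c, fun ε hε => ?_⟩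
  obtain ⟨n, hn, hn'⟩ := ((hlim.eventually (gt_mem_nhds (half_pos hε))).and
    (hc.eventually (Metric.ball_mem_nhds c (half_pos hε)))).exists
  exact ((hu n).mono_norm (mem_ball_iff_norm.1 hn').le).mono (by linarith)

theorem HasMean.add (h : HasMean f c) (h' : HasMean f' c') : HasMean (f + f') (c + c') := by
  intro ε hε
  obtain ⟨ι, _, _, a, ha⟩ := h (ε / 2) (half_pos hε)
  obtain ⟨κ, _, _, b, hb⟩ := h' (ε / 2) (half_pos hε)
  -- The products `a i * b j` serve both functions: `b j` is absorbed into the right factor for `f`,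
  -- and `a i` into the left factor for `f'`.
  refine ⟨ι × κ, inferInstance, inferInstance, fun p => a p.1 * b p.2, fun x y => ?_⟩
  have h1 : ‖(𝔼 j, 𝔼 i, f (x * (a i * b j) * y)) - c‖ ≤ ε / 2 :=
    norm_expect_sub_le fun j => by simpa only [mul_assoc] using ha x (b j * y)
  have h2 : ‖(𝔼 i, 𝔼 j, f' (x * (a i * b j) * y)) - c'‖ ≤ ε / 2 :=
    norm_expect_sub_le fun i => by simpa only [mul_assoc] using hb (x * a i) y
  rw [Finset.expect_comm] at h1
  have h3 : (𝔼 p : ι × κ, (f + f') (x * (a p.1 * b p.2) * y)) =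
      (𝔼 i, 𝔼 j, f (x * (a i * b j) * y)) + 𝔼 i, 𝔼 j, f' (x * (a i * b j) * y) := by
    simp only [Pi.add_apply, Finset.expect_add_distrib, ← Finset.univ_product_univ,
      Finset.expect_product]
  rw [h3, add_sub_add_comm]
  exact (norm_add_le _ _).trans (by linarith)

theorem HasMean.const_smul (h : HasMean f c) (r : ℂ) : HasMean (r • f) (r * c) := by
  intro ε hε
  obtain ⟨ι, _, _, a, ha⟩ := h (ε / (‖r‖ + 1)) (by positivity)
  refine ⟨ι, ‹_›, ‹_›, a, fun x y => ?_⟩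
  simp only [Pi.smul_apply, smul_eq_mul, ← Finset.mul_expect, ← mul_sub, norm_mul]
  calc ‖r‖ * _ ≤ (‖r‖ + 1) * (ε / (‖r‖ + 1)) := by
        gcongr
        · linarith
        · exact ha x y
    _ = ε := by field_simp

theorem hasMean_const (c : ℂ) : HasMean (fun _ : Γ => c) c := fun ε hε =>
  ⟨Unit, inferInstance, inferInstance, fun _ => 1, fun x y => by simp [hε.le]⟩

theorem HasMean.mul_left (h : HasMean f c) (g : Γ) : HasMean (fun x => f (g * x)) c := by
  intro ε hε
  obtain ⟨ι, _, _, a, ha⟩ := h ε hε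
  exact ⟨ι, ‹_›, ‹_›, a, fun x y => by simpa only [mul_assoc] using ha (g * x) y⟩

theorem HasMean.mul_right (h : HasMean f c) (g : Γ) : HasMean (fun x => f (x * g)) c := by
  intro ε hε
  obtain ⟨ι, _, _, a, ha⟩ := h ε hε
  exact ⟨ι, ‹_›, ‹_›, a, fun x y => by simpa only [mul_assoc] using ha x (y * g)⟩

theorem HasMean.nonneg (h : HasMean f c) (hf : ∀ g, 0 ≤ f g) : 0 ≤ c := by
  have hmem : c ∈ closure (Set.Ici (0 : ℂ)) := by
    rw [Metric.mem_closure_iff]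
    intro ε hε
    obtain ⟨ι, _, _, a, ha⟩ := h (ε / 2) (half_pos hε)
    refine ⟨𝔼 i, f (1 * a i * 1), ?_, ?_⟩
    · rw [Set.mem_Ici, Fintype.expect_eq_sum_div_card]
      refine div_nonneg (Finset.sum_nonneg fun i _ => hf _) (Nat.cast_nonneg _)
    · rw [dist_comm, dist_eq_norm]
      exact (ha 1 1).trans_lt (half_lt_self hε)
  rwa [isClosed_Ici.closure_eq] at hmem

/-- The group is partitioned into finitely many classes on each of which all two-sided translates
of `f` vary by at most `ε`. -/
def IsFineColoring {Γ κ : Type*} [Group Γ] (f : Γ → ℂ) (ε : ℝ) (p : Γ → κ) : Prop :=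
  ∀ a b, p a = p b → ∀ x y, ‖f (x * a * y) - f (x * b * y)‖ ≤ ε

theorem IsFineColoring.mul_mul {κ : Type*} {p : Γ → κ} (h : IsFineColoring f ε p) (g g' : Γ) :
    IsFineColoring f ε fun a => p (g * a * g') := by
  intro a b hab x y
  have := h _ _ hab (x * g⁻¹) (g'⁻¹ * y)
  simpa [mul_assoc] using this

theorem IsAlmostPeriodic.exists_finite_net (hf : IsAlmostPeriodic f) (hε : 0 < ε) :
    ∃ t : Finset Γ, ∀ g, ∃ g' ∈ t, ∀ x, ‖f (x * g) - f (x * g')‖ ≤ ε := by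
  classical
  obtain ⟨t, hts, htf, ht⟩ := totallyBounded_iff_subset.1 hf _
    ((UniformFun.hasBasis_uniformity Γ ℂ).mem_of_mem (Metric.dist_mem_uniformity hε))
  choose! k hk using fun u (hu : u ∈ t) => hts hu
  refine ⟨htf.toFinset.image k, fun g => ?_⟩
  obtain ⟨u, hu, hgu⟩ := Set.mem_iUnion₂.1 (ht ⟨g, rfl⟩)
  refine ⟨k u, Finset.mem_image_of_mem k (htf.mem_toFinset.2 hu), fun x => ?_⟩
  rw [← hk u hu] at hgu
  rw [← dist_eq_norm]
  exact (hgu x : dist (f (x * g)) (f (x * k u)) < ε).le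

/-- Colour `a` by the map sending each net element `i` to a net element approximating `a * i`. If
`a` and `b` share a colour, passing from `x * a * y` to `x * b * y` costs four approximations of `ε
/ 4`: replace `y` by `r y`, replace `a * r y` by the common net element, then undo both for `b`. -/
theorem IsAlmostPeriodic.exists_isFineColoring (hf : IsAlmostPeriodic f) (hε : 0 < ε) :
    ∃ (n : ℕ) (p : Γ → Fin n), IsFineColoring f ε p := by
  classical
  have hε4 : 0 < ε / 4 := by linarith
  obtain ⟨t, ht⟩ := hf.exists_finite_net hε4
  choose r hrt hr using ht
  let q : Γ → (t → t) := fun a i => ⟨r (a * i), hrt _⟩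
  refine ⟨_, fun a => Fintype.equivFin _ (q a), fun a b hab x y => ?_⟩
  have hq : r (a * r y) = r (b * r y) :=
    congrArg Subtype.val (congrFun ((Fintype.equivFin _).injective hab) ⟨r y, hrt y⟩)
  have h1 := hr y (x * a)
  have h2 := hr (a * r y) x
  have h3 := hr (b * r y) x
  have h4 := hr y (x * b)
  rw [← mul_assoc] at h2 h3
  rw [hq] at h2
  rw [← dist_eq_norm] at *
  have h5 := dist_triangle4 (f (x * a * y)) (f (x * a * r y)) (f (x * r (b * r y)))
    (f (x * b * r y))
  have h6 := dist_triangle (f (x * a * y)) (f (x * b * r y)) (f (x * b * y))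
  rw [dist_comm (f (x * r (b * r y)))] at h5
  rw [dist_comm (f (x * b * r y))] at h6
  linarith

theorem exists_isApproxMean_of_isFineColoring
    (h : ∃ (n : ℕ) (p : Γ → Fin n), IsFineColoring f ε p) :
    ∃ c, IsApproxMean f (ε + ε) c := by
  classical
  obtain ⟨n, ⟨p, hp⟩, hmin⟩ : ∃ n, (∃ p : Γ → Fin n, IsFineColoring f ε p) ∧
      ∀ m < n, ¬ ∃ p : Γ → Fin m, IsFineColoring f ε p :=
    ⟨Nat.find h, Nat.find_spec h, fun m hm => Nat.find_min h hm⟩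
  have hne : Nonempty (Fin n) := ⟨p 1⟩
  -- Hall's theorem matches the colours of `p` with those of its translate so that matched classes
  -- intersect.
  have hmatch : ∀ x y : Γ, ∃ σ : Fin n → Fin n, Function.Injective σ ∧
      ∀ i, ∃ a, p a = i ∧ p (x⁻¹ * a * y⁻¹) = σ i := by
    intro x y
    let q : Γ → Fin n := fun a => p (x⁻¹ * a * y⁻¹)
    have hq : IsFineColoring f ε q := hp.mul_mul _ _
    refine (Fintype.all_card_le_filter_rel_iff_exists_injective
      (fun i j => ∃ a, p a = i ∧ q a = j)).1 fun S => ?_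
    by_contra! hlt
    set T : Finset (Fin n) := {b | ∃ i ∈ S, ∃ a, p a = i ∧ q a = b} with hT
    have hTmem : ∀ a, p a ∈ S → q a ∈ T := fun a ha => by
      simp only [hT, Finset.mem_filter, Finset.mem_univ, true_and]
      exact ⟨p a, ha, a, rfl, rfl⟩
    -- If `S` meets too few translated classes, using the translated colour on `p ⁻¹' S` and the
    -- original colour elsewhere is still fine but has fewer than `n` colours, against minimality.
    let r : Γ → (↥Sᶜ ⊕ ↥T) := fun a =>
      if ha : p a ∈ S then Sum.inr ⟨q a, hTmem a ha⟩
      else Sum.inl ⟨p a, Finset.mem_compl.2 ha⟩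
    have hcard : Fintype.card (↥Sᶜ ⊕ ↥T) < n := by
      have hS := S.card_le_univ
      have hlt' : T.card < S.card := lt_of_eq_of_lt (by congr!) hlt
      simp only [Fintype.card_sum, Fintype.card_coe, Finset.card_compl]
      simp only [Fintype.card_fin] at hS ⊢
      omega
    refine hmin _ hcard ⟨fun a => Fintype.equivFin _ (r a), fun a b hab => ?_⟩
    have hr : r a = r b := (Fintype.equivFin _).injective hab
    by_cases ha : p a ∈ S <;> by_cases hb : p b ∈ S <;> simp [r, ha, hb] at hr
    · exact hq a b hr
    · exact hp a b hr
  choose s hs using fun i : Fin n => (by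
    obtain ⟨σ, -, hσ⟩ := hmatch 1 1
    exact (hσ i).imp fun a ha => ha.1 : ∃ a, p a = i)
  refine ⟨𝔼 i, f (s i), Fin n, inferInstance, hne, s, fun x y => ?_⟩
  obtain ⟨σ, hσ, hσa⟩ := hmatch x y
  choose a ha ha' using hσa
  have hbij : Function.Bijective σ := Finite.injective_iff_bijective.1 hσ
  rw [← Fintype.expect_bijective σ hbij (fun i => f (x * s (σ i) * y)) _ fun i => rfl]
  refine norm_expect_sub_expect_le fun i => ?_
  -- `s (σ i)` shares its colour with `x⁻¹ * a i * y⁻¹`, and `a i` shares its colour with `s i`;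
  -- each comparison costs `ε`.
  have h1 := hp (s (σ i)) (x⁻¹ * a i * y⁻¹) (by rw [hs, ha']) x y
  have h2 := hp (a i) (s i) (by rw [hs, ha]) 1 1
  simp only [mul_assoc, mul_inv_cancel_left, inv_mul_cancel, mul_one, one_mul] at h1 h2
  rw [← sub_add_sub_cancel _ (f (a i))]
  simpa only [mul_assoc] using (norm_add_le _ _).trans (add_le_add h1 h2)

theorem IsAlmostPeriodic.exists_hasMean (hf : IsAlmostPeriodic f) : ∃ c, HasMean f c := by
  refine exists_hasMean_of_forall_isApproxMean fun ε hε => ?_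
  have := exists_isApproxMean_of_isFineColoring (hf.exists_isFineColoring (half_pos hε))
  rwa [add_halves] at this

end Mean

/-! ### Existence and uniqueness of the invariant mean. -/

section InvariantMean

variable {Γ : Type*} [Group Γ]

theorem IsAlmostPeriodic.comp_uniformContinuous {f : Γ → ℂ} (hf : IsAlmostPeriodic f) {k : ℂ → ℂ}
    (hk : UniformContinuous k) : IsAlmostPeriodic (k ∘ f) := by
  have h := TotallyBounded.image hf (UniformFun.postcomp_uniformContinuous (α := Γ) hk)
  refine h.subset ?_
  rintro _ ⟨g, rfl⟩
  exact ⟨rightTranslate f g, ⟨g, rfl⟩, rfl⟩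

theorem IsInvariantMean.map_const {M : AlmostPeriodic Γ →ₗ[ℂ] ℂ} (hM : IsInvariantMean M) (c : ℂ) :
    M ⟨fun _ => c, isAlmostPeriodic_const c⟩ = c := by
  have h : (⟨fun _ => c, isAlmostPeriodic_const c⟩ : AlmostPeriodic Γ) =
      c • ⟨fun _ => 1, isAlmostPeriodic_const 1⟩ := by
    ext
    simp
  rw [h, map_smul, hM.map_one, smul_eq_mul, mul_one]

theorem IsInvariantMean.norm_le_of_abs_le {M : AlmostPeriodic Γ →ₗ[ℂ] ℂ} (hM : IsInvariantMean M)
    {f : AlmostPeriodic Γ} {r : Γ → ℝ} (hr : ∀ g, f.1 g = r g) {ε : ℝ} (h : ∀ g, |r g| ≤ ε) :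
    ‖M f‖ ≤ ε := by
  have h1 := hM.nonneg (⟨fun _ => (ε : ℂ), isAlmostPeriodic_const _⟩ - f) fun g => by
    change (0 : ℂ) ≤ ε - f.1 g
    rw [hr, ← Complex.ofReal_sub, Complex.zero_le_real]
    linarith [(abs_le.1 (h g)).2]
  have h2 := hM.nonneg (⟨fun _ => (ε : ℂ), isAlmostPeriodic_const _⟩ + f) fun g => by
    change (0 : ℂ) ≤ ε + f.1 g
    rw [hr, ← Complex.ofReal_add, Complex.zero_le_real]
    linarith [(abs_le.1 (h g)).1]
  rw [map_sub, hM.map_const, Complex.nonneg_iff] at h1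
  rw [map_add, hM.map_const, Complex.nonneg_iff] at h2
  simp only [Complex.sub_re, Complex.sub_im, Complex.add_re, Complex.add_im, Complex.ofReal_re,
    Complex.ofReal_im] at h1 h2
  -- Nonnegativity in the complex order includes being real.
  have him : (M f).im = 0 := by linarith
  have hre : M f = ((M f).re : ℂ) := Complex.ext rfl (by simpa using him)
  rw [hre, Complex.norm_real, Real.norm_eq_abs, abs_le]
  exact ⟨by linarith, by linarith⟩

/-- Real and imaginary parts are bounded separately; the lost factor 2 is harmless for the limiting
argument. -/
theorem IsInvariantMean.norm_le {M : AlmostPeriodic Γ →ₗ[ℂ] ℂ} (hM : IsInvariantMean M)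
    {f : AlmostPeriodic Γ} {ε : ℝ} (h : ∀ g, ‖f.1 g‖ ≤ ε) : ‖M f‖ ≤ ε + ε := by
  let u : AlmostPeriodic Γ := ⟨fun g => ((f.1 g).re : ℂ), f.2.comp_uniformContinuous
    (Complex.ofRealCLM.comp Complex.reCLM).uniformContinuous⟩
  let v : AlmostPeriodic Γ := ⟨fun g => ((f.1 g).im : ℂ), f.2.comp_uniformContinuous
    (Complex.ofRealCLM.comp Complex.imCLM).uniformContinuous⟩
  have hu : ‖M u‖ ≤ ε := hM.norm_le_of_abs_le (fun g => rfl)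
    fun g => (Complex.abs_re_le_norm _).trans (h g)
  have hv : ‖M v‖ ≤ ε := hM.norm_le_of_abs_le (fun g => rfl)
    fun g => (Complex.abs_im_le_norm _).trans (h g)
  have hf : f = u + Complex.I • v := by
    ext g
    change f.1 g = (f.1 g).re + Complex.I * (f.1 g).im
    rw [mul_comm, Complex.re_add_im]
  rw [hf, map_add, map_smul]
  refine (norm_add_le _ _).trans (add_le_add hu ?_)
  rwa [norm_smul, Complex.norm_I, one_mul]

/-- `M` does not distinguish `f` from an average of its left translates, and that average is
uniformly close to `c`. -/
theorem IsInvariantMean.eq_of_hasMean {M : AlmostPeriodic Γ →ₗ[ℂ] ℂ} (hM : IsInvariantMean M)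
    {f : AlmostPeriodic Γ} {c : ℂ} (h : HasMean f.1 c) : M f = c := by
  rw [← sub_eq_zero, ← norm_le_zero_iff]
  refine le_of_forall_pos_le_add fun ε hε => ?_
  obtain ⟨ι, _, _, a, ha⟩ := h (ε / 2) (half_pos hε)
  let F : AlmostPeriodic Γ :=
    (Fintype.card ι : ℂ)⁻¹ • ∑ i, ⟨fun y => f.1 (a i * y), IsAlmostPeriodic.mul_left f.2 (a i)⟩
  have hcard : (Fintype.card ι : ℂ) ≠ 0 := Nat.cast_ne_zero.2 Fintype.card_ne_zero
  have hF : M F = M f := by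
    simp only [F, map_smul, map_sum, hM.left_invariant, Finset.sum_const, Finset.card_univ,
      nsmul_eq_mul, smul_eq_mul]
    rw [inv_mul_cancel_left₀ hcard]
  have hFc := hM.norm_le (f := F - ⟨fun _ => c, isAlmostPeriodic_const c⟩) (ε := ε / 2) fun y => by
    have hFy : F.1 y = 𝔼 i, f.1 (1 * a i * y) := by
      simp [F, Fintype.expect_eq_sum_div_card, div_eq_inv_mul]
    change ‖F.1 y - c‖ ≤ ε / 2
    rw [hFy]
    exact ha 1 y
  rw [map_sub, hM.map_const, hF, add_halves] at hFc
  linarith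

variable (Γ) in
/-- The invariant mean on the almost periodic functions. -/
noncomputable def vonNeumannMean : AlmostPeriodic Γ →ₗ[ℂ] ℂ where
  toFun f := f.2.exists_hasMean.choose
  map_add' f f' := (f + f').2.exists_hasMean.choose_spec.unique
    (f.2.exists_hasMean.choose_spec.add f'.2.exists_hasMean.choose_spec)
  map_smul' r f := (r • f).2.exists_hasMean.choose_spec.unique
    (f.2.exists_hasMean.choose_spec.const_smul r)

theorem hasMean_vonNeumannMean (f : AlmostPeriodic Γ) : HasMean f.1 (vonNeumannMean Γ f) :=
  f.2.exists_hasMean.choose_spec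

theorem isInvariantMean_vonNeumannMean : IsInvariantMean (vonNeumannMean Γ) where
  map_one := (hasMean_vonNeumannMean _).unique (hasMean_const 1)
  nonneg f hf := (hasMean_vonNeumannMean f).nonneg hf
  left_invariant a f :=
    (hasMean_vonNeumannMean _).unique ((hasMean_vonNeumannMean f).mul_left a)
  right_invariant a f :=
    (hasMean_vonNeumannMean _).unique ((hasMean_vonNeumannMean f).mul_right a)

theorem IsInvariantMean.eq_vonNeumannMean {M : AlmostPeriodic Γ →ₗ[ℂ] ℂ} (hM : IsInvariantMean M) :
    M = vonNeumannMean Γ :=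
  LinearMap.ext fun f => hM.eq_of_hasMean (hasMean_vonNeumannMean f)

theorem IsInvariantMean.hasMean {M : AlmostPeriodic Γ →ₗ[ℂ] ℂ} (hM : IsInvariantMean M)
    (f : AlmostPeriodic Γ) : HasMean f.1 (M f) := by
  rw [hM.eq_vonNeumannMean]
  exact hasMean_vonNeumannMean f

end InvariantMean

/-! ### Almost periodicity along orbits, and finite orbits. -/

section Orbit

variable {Γ X : Type*} [Group Γ] [MulAction Γ X]

/-- Stability makes `y ↦ φ_y` continuous for uniform convergence, so its range is compact; the
translate of `φ_x` by `g` is `φ_{gx}`, which lies in it. -/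
theorem LyapunovStable.isAlmostPeriodic_orbitFunction [UniformSpace X] [CompactSpace X]
    (h : LyapunovStable Γ X) (φ : C(X, ℂ)) (x : X) : IsAlmostPeriodic (orbitFunction Γ φ x) := by
  have hcont : Continuous fun y : X => UniformFun.ofFun (orbitFunction Γ φ y) := by
    refine continuous_iff_continuousAt.2 fun y => ?_
    refine UniformFun.tendsto_iff_tendstoUniformly.2 fun u hu => ?_
    obtain ⟨V, hV, hVu⟩ :=
      h _ (CompactSpace.uniformContinuous_of_continuous φ.continuous hu) y
    exact Filter.mem_of_superset (mem_nhds_left y hV) fun z hz g => hVu z hz g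
  refine (isCompact_range hcont).totallyBounded.subset ?_
  rintro _ ⟨g, rfl⟩
  refine ⟨g • x, ?_⟩
  funext k
  exact congrArg φ (mul_smul k g x).symm

theorem LyapunovStable.subMulAction [UniformSpace X] (h : LyapunovStable Γ X)
    (Y : SubMulAction Γ X) : LyapunovStable Γ Y := by
  intro U hU x
  rw [uniformity_subtype, Filter.mem_comap] at hU
  obtain ⟨U', hU', hUU'⟩ := hU
  obtain ⟨V, hV, hVU⟩ := h U' hU' x
  refine ⟨(fun q : Y × Y => ((q.1 : X), (q.2 : X))) ⁻¹' V, ?_, fun y hy g => hUU' ?_⟩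
  · rw [uniformity_subtype]
    exact Filter.preimage_mem_comap hV
  · exact hVU y hy g

theorem isAlmostPeriodic_orbitFunction_of_finite [TopologicalSpace X] {x : X}
    (hfin : (MulAction.orbit Γ x).Finite) (φ : C(X, ℂ)) :
    IsAlmostPeriodic (orbitFunction Γ φ x) := by
  refine (hfin.image fun y => UniformFun.ofFun (orbitFunction Γ φ y)).totallyBounded.subset ?_
  rintro _ ⟨g, rfl⟩
  refine ⟨g • x, MulAction.mem_orbit x g, ?_⟩
  funext k
  exact congrArg φ (mul_smul k g x).symm

theorem HasMean.eq_average_of_finite_orbit [TopologicalSpace X] {x : X}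
    (hfin : (MulAction.orbit Γ x).Finite) {φ : C(X, ℂ)} {c : ℂ}
    (h : HasMean (orbitFunction Γ φ x) c) :
    c = (1 / (hfin.toFinset.card : ℂ)) * ∑ y ∈ hfin.toFinset, φ y := by
  have := hfin.fintype
  have : Nonempty (MulAction.orbit Γ x) := ⟨⟨x, MulAction.mem_orbit_self x⟩⟩
  have havg : (1 / (hfin.toFinset.card : ℂ)) * ∑ y ∈ hfin.toFinset, φ y =
      𝔼 y : MulAction.orbit Γ x, φ y := by
    rw [Fintype.expect_eq_sum_div_card, one_div_mul_eq_div, hfin.card_toFinset,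
      Finset.sum_subtype hfin.toFinset (fun y => hfin.mem_toFinset) fun y => φ y]
  rw [havg, eq_comm, ← sub_eq_zero, ← norm_le_zero_iff]
  refine le_of_forall_pos_le_add fun ε hε => ?_
  obtain ⟨ι, _, _, a, ha⟩ := h ε hε
  -- Each `a i` permutes the orbit, so translating by it leaves the orbit average unchanged.
  have hswap : (𝔼 y : MulAction.orbit Γ x, 𝔼 i, φ (a i • (y : X))) =
      𝔼 y : MulAction.orbit Γ x, φ y := by
    rw [Finset.expect_comm]
    calc (𝔼 i, 𝔼 y : MulAction.orbit Γ x, φ (a i • (y : X)))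
        = 𝔼 _i : ι, 𝔼 y : MulAction.orbit Γ x, φ y := Finset.expect_congr rfl fun i _ =>
          Fintype.expect_equiv (MulAction.toPerm (a i)) _ _ fun y => rfl
      _ = _ := Fintype.expect_const _
  rw [← hswap, zero_add]
  refine norm_expect_sub_le fun y => ?_
  obtain ⟨_, g, rfl⟩ := y
  simpa [orbitFunction, mul_smul] using ha 1 g

end Orbit

/-! ### Means as integrals, and unique ergodicity. -/

section Measure

variable {Γ Y : Type*} [Group Γ] [MulAction Γ Y]

theorem HasMean.eq_integral [TopologicalSpace Y] [CompactSpace Y] [MeasurableSpace Y]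
    [BorelSpace Y] [ContinuousConstSMul Γ Y] {x : Y} (hx : Dense (MulAction.orbit Γ x))
    (μ : Measure Y) [IsProbabilityMeasure μ] [SMulInvariantMeasure Γ Y μ] {φ : C(Y, ℂ)} {c : ℂ}
    (h : HasMean (orbitFunction Γ φ x) c) : c = ∫ y, φ y ∂μ := by
  rw [eq_comm, ← sub_eq_zero, ← norm_le_zero_iff]
  refine le_of_forall_pos_le_add fun ε hε => ?_
  obtain ⟨ι, _, _, a, ha⟩ := h ε hε
  have hcont : ∀ i, Continuous fun y => φ (a i • y) := fun i =>
    φ.continuous.comp (continuous_const_smul (a i))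
  have hint : ∀ i, Integrable (fun y => φ (a i • y)) μ := fun i =>
    (hcont i).integrable_of_hasCompactSupport (HasCompactSupport.of_compactSpace _)
  -- The estimate holds at orbit points `g • x` and is a closed condition, so density extends it to
  -- all of `Y`, where it can be integrated.
  have hbound : ∀ y, ‖(∑ i, φ (a i • y)) / Fintype.card ι - c‖ ≤ ε := by
    have hclosed : IsClosed {y : Y | ‖(∑ i, φ (a i • y)) / Fintype.card ι - c‖ ≤ ε} :=
      isClosed_le ((((continuous_finsetSum _ fun i _ => hcont i).div_const _).sub
        continuous_const).norm) continuous_const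
    intro y
    refine closure_minimal ?_ hclosed (hx y)
    rintro _ ⟨g, rfl⟩
    have := ha 1 g
    rw [Fintype.expect_eq_sum_div_card] at this
    simpa [orbitFunction, mul_smul] using this
  have hcard : (Fintype.card ι : ℂ) ≠ 0 := Nat.cast_ne_zero.2 Fintype.card_ne_zero
  have hI : ∫ y, ((∑ i, φ (a i • y)) / Fintype.card ι - c) ∂μ = (∫ y, φ y ∂μ) - c := by
    rw [integral_sub ((integrable_finsetSum _ fun i _ => hint i).div_const _)
      (integrable_const c), integral_div, integral_finsetSum _ fun i _ => hint i]
    simp only [integral_smul_eq_self (μ := μ) (fun y => φ y), Finset.sum_const, Finset.card_univ,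
      nsmul_eq_mul, integral_const, probReal_univ, one_smul]
    rw [mul_div_cancel_left₀ _ hcard]
  have := norm_integral_le_of_norm_le_const (μ := μ) (Filter.Eventually.of_forall hbound)
  rwa [hI, probReal_univ, mul_one, ← zero_add ε] at this

/-- The complexification of a real continuous function. -/
def ContinuousMap.toComplex [TopologicalSpace Y] (ψ : C(Y, ℝ)) : C(Y, ℂ) :=
  ⟨fun y => (ψ y : ℂ), Complex.continuous_ofReal.comp ψ.continuous⟩

/-- Existence: the mean of `ψ_x` is a positive functional of `ψ`, represented by a Riesz measure.
Uniqueness: any competitor has the same integrals by `HasMean.eq_integral`. -/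
theorem LyapunovStable.existsUnique_measure [UniformSpace Y] [CompactSpace Y] [T2Space Y]
    [MeasurableSpace Y] [BorelSpace Y] [ContinuousConstSMul Γ Y] (hY : LyapunovStable Γ Y) {x : Y}
    (hx : Dense (MulAction.orbit Γ x)) :
    ∃! μ : Measure Y, IsProbabilityMeasure μ ∧ SMulInvariantMeasure Γ Y μ ∧ μ.Regular := by
  have hM := isInvariantMean_vonNeumannMean (Γ := Γ)
  let F : CompactlySupportedContinuousMap Y ℝ → AlmostPeriodic Γ := fun ψ =>
    ⟨orbitFunction Γ ψ.toContinuousMap.toComplex x, hY.isAlmostPeriodic_orbitFunction _ x⟩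
  let L : CompactlySupportedContinuousMap Y ℝ →ₗ[ℝ] ℝ :=
    { toFun := fun ψ => (vonNeumannMean Γ (F ψ)).re
      map_add' := fun ψ ψ' => by
        have : F (ψ + ψ') = F ψ + F ψ' := by
          ext g
          exact Complex.ofReal_add _ _
        rw [this, map_add, Complex.add_re]
      map_smul' := fun r ψ => by
        have : F (r • ψ) = (r : ℂ) • F ψ := by
          ext g
          exact Complex.ofReal_mul _ _
        rw [this, map_smul, smul_eq_mul, Complex.re_ofReal_mul]
        rfl }
  let Λ : PositiveLinearMap ℝ (CompactlySupportedContinuousMap Y ℝ) ℝ :=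
    PositiveLinearMap.mk₀ L fun ψ hψ => (Complex.nonneg_iff.1 (hM.nonneg (F ψ) fun g =>
      Complex.zero_le_real.2 (hψ (g • x)))).1
  have hΛ : ∀ ψ, ∫ y, ψ y ∂(RealRMK.rieszMeasure Λ) = (vonNeumannMean Γ (F ψ)).re :=
    RealRMK.integral_rieszMeasure Λ
  have hprob : IsProbabilityMeasure (RealRMK.rieszMeasure Λ) := by
    have h1 := hΛ ⟨1, HasCompactSupport.of_compactSpace _⟩
    have hF : F ⟨1, HasCompactSupport.of_compactSpace _⟩ =
        ⟨fun _ => 1, isAlmostPeriodic_const 1⟩ := by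
      ext g
      exact Complex.ofReal_one
    rw [hF, hM.map_one] at h1
    have h2 : ∫ _y : Y, (1 : ℝ) ∂(RealRMK.rieszMeasure Λ) = 1 := h1
    rw [integral_const, smul_eq_mul, mul_one] at h2
    exact ⟨(ENNReal.toReal_eq_one_iff _).1 h2⟩
  refine ⟨RealRMK.rieszMeasure Λ, ⟨hprob, ⟨fun g s hs => ?_⟩, inferInstance⟩, ?_⟩
  · have hreg : ((RealRMK.rieszMeasure Λ).map (g • · : Y → Y)).Regular :=
      Measure.Regular.map (Homeomorph.smul g)
    have hmeas : Measurable (g • · : Y → Y) := measurable_const_smul g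
    have hmap : (RealRMK.rieszMeasure Λ).map (g • · : Y → Y) = RealRMK.rieszMeasure Λ := by
      refine Measure.ext_of_integral_eq_on_compactlySupported fun ψ => ?_
      rw [integral_map (f := fun y => ψ y) hmeas.aemeasurable
        (map_continuous ψ).aestronglyMeasurable, hΛ]
      refine (hΛ ⟨⟨fun y => ψ (g • y), (map_continuous ψ).comp (continuous_const_smul g)⟩,
        HasCompactSupport.of_compactSpace _⟩).trans ?_
      -- Replacing `ψ` by `ψ (g • ·)` left-translates the orbit function by `g`.
      rw [← hM.left_invariant g (F ψ)]
      congr 2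
      ext k
      exact congrArg (fun z => (ψ z : ℂ)) (mul_smul g k x).symm
    conv_rhs => rw [← hmap, Measure.map_apply hmeas hs]
  · rintro ν ⟨_, _, _⟩
    refine Measure.ext_of_integral_eq_on_compactlySupported fun ψ => ?_
    rw [hΛ, (hasMean_vonNeumannMean (F ψ)).eq_integral hx ν]
    change _ = (∫ y, (ψ y : ℂ) ∂ν).re
    rw [integral_complex_ofReal, Complex.ofReal_re]

end Measure

/-! ### The orbit closure as a space with a dense orbit. -/

section OrbitClosure

variable {Γ X : Type*} [Group Γ] [TopologicalSpace X] [MulAction Γ X] [ContinuousConstSMul Γ X]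

instance SubMulAction.continuousConstSMul (Y : SubMulAction Γ X) : ContinuousConstSMul Γ Y :=
  ⟨fun g => ((continuous_const_smul g).comp continuous_subtype_val).subtype_mk _⟩

theorem mem_orbitClosure_self (x : X) : x ∈ orbitClosure Γ x :=
  subset_closure (MulAction.mem_orbit_self x)

theorem dense_orbit_orbitClosure (x : X) :
    Dense (MulAction.orbit Γ (⟨x, mem_orbitClosure_self x⟩ : orbitClosure Γ x)) := by
  intro y
  rw [closure_subtype]
  have h : ((↑) : orbitClosure Γ x → X) ''
      MulAction.orbit Γ (⟨x, mem_orbitClosure_self x⟩ : orbitClosure Γ x) =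
      MulAction.orbit Γ x := by
    ext z
    simp [MulAction.orbit]
  rw [h]
  exact y.2

end OrbitClosure

theorem mainTheorem2 {Γ : Type*} [Group Γ] {X : Type*} [UniformSpace X] [CompactSpace X]
    [T2Space X] [MeasurableSpace X] [BorelSpace X] [MulAction Γ X] [ContinuousConstSMul Γ X] :
    (∃! M : AlmostPeriodic Γ →ₗ[ℂ] ℂ, IsInvariantMean M) ∧
    ∀ M : AlmostPeriodic Γ →ₗ[ℂ] ℂ, IsInvariantMean M →
      (LyapunovStable Γ X → ∀ x : X,
        (∃! μ : Measure (orbitClosure Γ x), IsInvariantProbability μ) ∧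
        ∀ μ : Measure (orbitClosure Γ x), IsInvariantProbability μ → ∀ φ : C(X, ℂ),
          ∃ hφ : orbitFunction Γ φ x ∈ AlmostPeriodic Γ,
            M ⟨orbitFunction Γ φ x, hφ⟩ = ∫ y : orbitClosure Γ x, φ (y : X) ∂μ) ∧
      (∀ (x : X) (hfin : (MulAction.orbit Γ x).Finite) (φ : C(X, ℂ)),
        ∃ hφ : orbitFunction Γ φ x ∈ AlmostPeriodic Γ,
          M ⟨orbitFunction Γ φ x, hφ⟩ =
            (1 / (hfin.toFinset.card : ℂ)) * ∑ y ∈ hfin.toFinset, φ y) := by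
  refine ⟨⟨vonNeumannMean Γ, isInvariantMean_vonNeumannMean, fun M hM => hM.eq_vonNeumannMean⟩,
    fun M hM => ⟨fun hX x => ?_, fun x hfin φ => ?_⟩⟩
  · have : CompactSpace (orbitClosure Γ x) :=
      isCompact_iff_compactSpace.1 (isClosed_closure (s := MulAction.orbit Γ x)).isCompact
    have : BorelSpace (orbitClosure Γ x) := Subtype.borelSpace (closure (MulAction.orbit Γ x))
    have hdense := dense_orbit_orbitClosure (Γ := Γ) x
    refine ⟨?_, fun μ hμ φ => ⟨hX.isAlmostPeriodic_orbitFunction φ x, ?_⟩⟩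
    · obtain ⟨μ, ⟨h1, h2, h3⟩, huniq⟩ :=
        (hX.subMulAction (orbitClosure Γ x)).existsUnique_measure hdense
      exact ⟨μ, ⟨h1, h2, h3⟩, fun ν hν => huniq ν ⟨hν.prob, hν.invariant, hν.regular⟩⟩
    · have := hμ.prob
      have := hμ.invariant
      exact HasMean.eq_integral hdense μ (φ := φ.comp ⟨Subtype.val, continuous_subtype_val⟩)
        (hM.hasMean ⟨_, hX.isAlmostPeriodic_orbitFunction φ x⟩)
  · have hφ := isAlmostPeriodic_orbitFunction_of_finite hfin φ
    exact ⟨hφ, (hM.hasMean ⟨_, hφ⟩).eq_average_of_finite_orbit hfin⟩
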